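/- For $s\in(0,1)$ and $\theta\in(0,\pi)$ let $$M(\theta,s)=2\int_0^\theta\left[\int_0^{+\infty}\frac{r\,dr}{(r^2+2r\cos t+1)^{\frac{2+s}{2}}}\right]dt .$$ For every $s\in(0,1)$ and $\sigma\in(-1,1)$ the equation (fractional Young's law) $$1+\sigma=(\sin\theta)^s\,\frac{M(\theta,s)}{M\left(\frac\pi2,s\right)}$$ has exactly one solution $\theta=\theta(s,\sigma)\in(0,\pi)$. For every $s\in(0,1)$ the function $\theta(s,\cdot)$ is strictly increasing on $(-1,1)$, and for every $\sigma\in(-1,1)$ we have $$\theta(s,\sigma)=\arccos(-\sigma)-\frac{2\sigma\log 2+(1-\sigma)\log(1-\sigma)-(1+\sigma)\log(1+\sigma)}{2\sqrt{1-\sigma^2}}\,(1-s)+o(1-s)\qquad\text{as } s\to1^-,$$ and $$\theta(s,\sigma)=\frac\pi2(1+\sigma)-\left[\frac\pi2(1+\sigma)\log\left(\cos\frac{\pi\sigma}2\right)-\Xi\left(\frac\pi2(1+\sigma)\right)+(1+\sigma)\,\Xi\left(\frac\pi2\right)\right]s+o(s)\qquad\text{as } s\to0^+,$$ where $\Xi(\alpha)=\int_0^\alpha\frac{t}{\tan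 t}\,dt$ for $\alpha\in[0,\pi)$. -/

import Mathlib

noncomputable section

/-- `M(θ, s) = 2 ∫₀^θ ∫₀^∞ r / (r² + 2 r cos t + 1)^((2+s)/2) dr dt`. -/
def youngM (θ s : ℝ) : ℝ :=
  2 * ∫ t in (0 : ℝ)..θ, ∫ r in Set.Ioi (0 : ℝ),
    r / (r ^ 2 + 2 * r * Real.cos t + 1) ^ ((2 + s) / 2)

/-- `α` is an angle in `(0, π)` that solves the fractional Young's law with
fractional parameter `s` and relative adhesion coefficient `σ`. -/
def IsContactAngle (s σ α : ℝ) : Prop :=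
  α ∈ Set.Ioo 0 Real.pi ∧
    1 + σ = Real.sin α ^ s * (youngM α s / youngM (Real.pi / 2) s)

/-- The fractional contact angle `θ(s, σ)`: the solution of the fractional Young's law.
(Arbitrary where there is no solution; that the solution exists and is unique for
`s ∈ (0, 1)` and `σ ∈ (-1, 1)` has to be proved.) -/
def contactAngle (s σ : ℝ) : ℝ :=
  Classical.epsilon (IsContactAngle s σ)

/-- `Ξ(α) = ∫₀^α t / tan t dt`. -/
def youngXi (α : ℝ) : ℝ :=
  ∫ t in (0 : ℝ)..α, t / Real.tan t

end

section FractionalYoung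

open Real Set Filter Topology MeasureTheory

/-! Write S_s(θ) = ∫₀^θ sin^s. The crux is M(θ, s) = (2/s) (sin θ)^(-s) S_s(θ) (`youngM_eq`): the
powers of the sine cancel in Young's law, which becomes (1 + σ) S_s(π/2) = S_s(θ). Since S_s
increases strictly from 0 to S_s(π) = 2 S_s(π/2) on [0, π], there is exactly one root, and it
increases with σ.

At the end points the reduced equation is explicit: S_0(θ) = θ and S_1(θ) = 1 - cos θ.
`isLittleO_branch` differentiates it implicitly in s; the s-derivative of S_s at s₀ is ∫ sin^s₀ log
sin, by dominated convergence. This integral is elementary for s₀ = 1 and is expressed through Ξ for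
s₀ = 0. -/

/-- The primitive `∫₀^θ (sin φ)^s dφ`. -/
noncomputable def sinPowInt (s θ : ℝ) : ℝ := ∫ φ in (0 : ℝ)..θ, sin φ ^ s

theorem continuous_sin_rpow {s : ℝ} (hs : 0 ≤ s) : Continuous fun φ : ℝ => sin φ ^ s :=
  continuous_sin.rpow_const fun _ => Or.inr hs

theorem hasDerivAt_sinPowInt {s : ℝ} (hs : 0 ≤ s) (θ : ℝ) :
    HasDerivAt (sinPowInt s) (sin θ ^ s) θ :=
  (continuous_sin_rpow hs).integral_hasStrictDerivAt 0 θ |>.hasDerivAt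

theorem continuous_sinPowInt {s : ℝ} (hs : 0 ≤ s) : Continuous (sinPowInt s) :=
  continuous_iff_continuousAt.2 fun θ => (hasDerivAt_sinPowInt hs θ).continuousAt

theorem sinPowInt_zero (s : ℝ) : sinPowInt s 0 = 0 := by simp [sinPowInt]

theorem strictMonoOn_sinPowInt {s : ℝ} (hs : 0 ≤ s) :
    StrictMonoOn (sinPowInt s) (Icc 0 π) := by
  refine strictMonoOn_of_deriv_pos (convex_Icc _ _) (continuous_sinPowInt hs).continuousOn ?_
  intro x hx
  rw [interior_Icc] at hx
  rw [(hasDerivAt_sinPowInt hs x).deriv]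
  exact rpow_pos_of_pos (sin_pos_of_mem_Ioo hx) _

theorem sinPowInt_pi {s : ℝ} (hs : 0 ≤ s) : sinPowInt s π = 2 * sinPowInt s (π / 2) := by
  have h1 : ∫ φ in (π / 2)..π, sin φ ^ s = ∫ φ in (0 : ℝ)..(π / 2), sin φ ^ s := by
    have := intervalIntegral.integral_comp_sub_left (a := 0) (b := π / 2)
      (fun φ : ℝ => sin φ ^ s) π
    simp only [sin_pi_sub, sub_zero] at this
    rw [this, show π - π / 2 = π / 2 by ring]
  have h2 := intervalIntegral.integral_add_adjacent_intervals
    ((continuous_sin_rpow hs).intervalIntegrable (μ := volume) 0 (π / 2))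
    ((continuous_sin_rpow hs).intervalIntegrable (μ := volume) (π / 2) π)
  unfold sinPowInt
  rw [← h2, h1]
  ring

theorem sinPowInt_pi_div_two_pos {s : ℝ} (hs : 0 ≤ s) : 0 < sinPowInt s (π / 2) := by
  have h := strictMonoOn_sinPowInt hs (left_mem_Icc.2 pi_pos.le)
    (⟨by positivity, by linarith [pi_pos]⟩ : π / 2 ∈ Icc 0 π) (by positivity)
  rwa [sinPowInt_zero] at h

/-! ### Closed form of `youngM` -/

theorem quadratic_pos {t : ℝ} (ht : t ∈ Ioo 0 π) (r : ℝ) :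
    0 < r ^ 2 + 2 * r * cos t + 1 := by
  have h : r ^ 2 + 2 * r * cos t + 1 = (r + cos t) ^ 2 + sin t ^ 2 := by
    rw [sin_sq]; ring
  have := sin_pos_of_mem_Ioo ht
  rw [h]
  positivity

/-- The radial integral in `youngM`, in terms of the primitive of `sin ^ s`. -/
theorem integral_radial {s t : ℝ} (hs : 0 < s) (ht : t ∈ Ioo 0 π) :
    ∫ r in Ioi (0 : ℝ), r / (r ^ 2 + 2 * r * cos t + 1) ^ ((2 + s) / 2) =
      1 / s - cos t * (sin t ^ (-1 - s) * sinPowInt s t) := by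
  have hst := sin_pos_of_mem_Ioo ht
  set q : ℝ → ℝ := fun r => r ^ 2 + 2 * r * cos t + 1 with hq
  have hqpos : ∀ r, 0 < q r := quadratic_pos ht
  -- Substitution r + cos t = sin t · cot ψ: the angle ψ falls from t at r = 0 to 0 at infinity, and
  -- sin ψ = sin t / √q.
  set ψ : ℝ → ℝ := fun r => π / 2 - arctan ((r + cos t) / sin t) with hψ
  have hqd : ∀ r, HasDerivAt q (2 * (r + cos t)) r := fun r => by
    have := (((hasDerivAt_id r).pow 2).add
      (((hasDerivAt_id r).const_mul 2).mul_const (cos t))).add_const 1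
    refine (this.congr_deriv ?_)
    simp; ring
  have hone : ∀ r, 1 + ((r + cos t) / sin t) ^ 2 = q r / sin t ^ 2 := fun r => by
    have : q r = (r + cos t) ^ 2 + sin t ^ 2 := by
      simp only [hq]; rw [sin_sq]; ring
    rw [this]; field_simp; ring
  have hψd : ∀ r, HasDerivAt ψ (-(sin t / q r)) r := fun r => by
    have h := ((((hasDerivAt_id r).add_const (cos t)).div_const (sin t)).arctan).const_sub (π / 2)
    refine h.congr_deriv ?_
    simp only [id]
    rw [hone]
    have := hqpos r
    field_simp
  have hsinψ : ∀ r, sin (ψ r) = sin t * q r ^ (-(1 / 2) : ℝ) := fun r => by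
    simp only [hψ]
    rw [sin_pi_div_two_sub, cos_arctan, hone, sqrt_div' _ (by positivity), sqrt_sq hst.le,
      rpow_neg (hqpos r).le, ← sqrt_eq_rpow]
    have := sqrt_pos.2 (hqpos r)
    field_simp
  -- Split r = (r + cos t) - cos t: the first part is a multiple of q', the second becomes sin^s ψ
  -- dψ.
  have hder : ∀ r ∈ Ici (0 : ℝ), HasDerivAt
      (fun r => -(1 / s) * q r ^ (-(s / 2)) +
        cos t * (sin t ^ (-1 - s) * sinPowInt s (ψ r)))
      (r / q r ^ ((2 + s) / 2)) r := fun r _ => by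
    have h1 := ((hqd r).rpow_const (p := -(s / 2)) (Or.inl (hqpos r).ne')).const_mul (-(1 / s))
    have h2 := ((((hasDerivAt_sinPowInt hs.le (ψ r)).comp r (hψd r)).const_mul
      (sin t ^ (-1 - s))).const_mul (cos t))
    refine (h1.add h2).congr_deriv ?_
    rw [hsinψ, mul_rpow hst.le (rpow_nonneg (hqpos r).le _), ← rpow_mul (hqpos r).le]
    have e1 : q r ^ ((2 + s) / 2) = q r * q r ^ (s / 2) := by
      rw [show (2 + s) / 2 = 1 + s / 2 by ring, rpow_add (hqpos r), rpow_one]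
    have e2 : q r ^ (-(s / 2) - 1) = (q r * q r ^ (s / 2))⁻¹ := by
      rw [← e1, ← rpow_neg (hqpos r).le]; congr 1; ring
    have e3 : q r ^ (-(1 / 2) * s) = (q r ^ (s / 2))⁻¹ := by
      rw [← rpow_neg (hqpos r).le]; congr 1; ring
    have e4 : sin t ^ (-1 - s) = (sin t * sin t ^ s)⁻¹ := by
      rw [show -1 - s = -(1 + s) by ring, rpow_neg hst.le, rpow_add hst, rpow_one]
    rw [e1, e2, e3, e4]
    have p1 := rpow_pos_of_pos (hqpos r) (s / 2)
    have p2 := rpow_pos_of_pos hst s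
    have p3 := hqpos r
    field_simp
    ring
  have hqlim : Tendsto q atTop atTop := by
    have : ∀ᶠ r : ℝ in atTop, r ≤ q r := by
      filter_upwards [eventually_ge_atTop 3] with r hr
      simp only [hq]
      nlinarith [neg_one_le_cos t]
    exact tendsto_atTop_mono' _ this tendsto_id
  have hψlim : Tendsto ψ atTop (𝓝 0) := by
    have h : Tendsto (fun r : ℝ => (r + cos t) / sin t) atTop atTop :=
      (tendsto_atTop_add_const_right _ _ tendsto_id).atTop_div_const hst
    have := ((tendsto_arctan_atTop.mono_right nhdsWithin_le_nhds).comp h).const_sub (π / 2)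
    simpa using! this
  have hlim : Tendsto (fun r => -(1 / s) * q r ^ (-(s / 2)) +
        cos t * (sin t ^ (-1 - s) * sinPowInt s (ψ r))) atTop (𝓝 0) := by
    have h1 := ((tendsto_rpow_neg_atTop (half_pos hs)).comp hqlim).const_mul (-(1 / s))
    have h2 := ((((continuous_sinPowInt hs.le).tendsto 0).comp hψlim).const_mul
      (sin t ^ (-1 - s))).const_mul (cos t)
    rw [sinPowInt_zero] at h2
    simpa using! h1.add h2
  have hψ0 : ψ 0 = t := by
    have : cos t / sin t = tan (π / 2 - t) := by
      rw [tan_eq_sin_div_cos, sin_pi_div_two_sub, cos_pi_div_two_sub]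
    simp only [hψ, zero_add]
    rw [this, arctan_tan (by linarith [ht.2]) (by linarith [ht.1])]
    ring
  have key := integral_Ioi_of_hasDerivAt_of_nonneg' hder
    (fun r hr => div_nonneg (le_of_lt hr) (rpow_nonneg (hqpos r).le _)) hlim
  rw [key, hψ0]
  simp [hq]
  ring

theorem hasDerivAt_sin_rpow_mul_sinPowInt {s t : ℝ} (hs : 0 < s) (ht : t ∈ Ioo 0 π) :
    HasDerivAt (fun t => 1 / s * (sin t ^ (-s) * sinPowInt s t))
      (∫ r in Ioi (0 : ℝ), r / (r ^ 2 + 2 * r * cos t + 1) ^ ((2 + s) / 2)) t := by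
  have hst := sin_pos_of_mem_Ioo ht
  have h := ((((hasDerivAt_sin t).rpow_const (p := -s) (Or.inl hst.ne')).mul
    (hasDerivAt_sinPowInt hs.le t)).const_mul (1 / s))
  refine h.congr_deriv ?_
  rw [integral_radial hs ht, show -s - 1 = -1 - s by ring, ← rpow_add hst, neg_add_cancel,
    rpow_zero]
  field_simp
  ring

/-- Only t = 0 is delicate: sin^s is increasing on [0, π/2], so S_s(x) ≤ x sin^s x there and the
product is squeezed between 0 and x. -/
theorem continuousOn_sin_rpow_mul_sinPowInt {s θ : ℝ} (hs : 0 < s) (hθ : θ ∈ Ioo 0 π) :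
    ContinuousOn (fun t => 1 / s * (sin t ^ (-s) * sinPowInt s t)) (Icc 0 θ) := by
  intro t ht
  rcases eq_or_lt_of_le ht.1 with rfl | h0
  · refine ContinuousWithinAt.mul continuousWithinAt_const ?_
    have hz : sin (0 : ℝ) ^ (-s) * sinPowInt s 0 = 0 := by rw [sinPowInt_zero, mul_zero]
    change Tendsto _ _ (𝓝 (sin (0 : ℝ) ^ (-s) * sinPowInt s 0))
    rw [hz]
    have hid : Tendsto (fun t : ℝ => t) (𝓝[Icc 0 θ] 0) (𝓝 0) := nhdsWithin_le_nhds
    have hev : ∀ᶠ t : ℝ in 𝓝[Icc 0 θ] 0, t ∈ Icc 0 (π / 2) := by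
      filter_upwards [self_mem_nhdsWithin, nhdsWithin_le_nhds (Iio_mem_nhds (half_pos pi_pos))]
        with x h1 h2 using ⟨h1.1, le_of_lt h2⟩
    refine tendsto_of_tendsto_of_tendsto_of_le_of_le' tendsto_const_nhds hid ?_ ?_
    · filter_upwards [hev] with x hx
      have hx' : x ∈ Icc 0 π := ⟨hx.1, by linarith [hx.2, pi_pos]⟩
      have h3 := (strictMonoOn_sinPowInt hs.le).monotoneOn (left_mem_Icc.2 pi_pos.le) hx' hx.1
      rw [sinPowInt_zero] at h3
      exact mul_nonneg (rpow_nonneg (sin_nonneg_of_mem_Icc hx') _) h3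
    · filter_upwards [hev] with x hx
      rcases eq_or_lt_of_le hx.1 with rfl | hx0
      · rw [hz]
      have hxs : 0 < sin x := sin_pos_of_pos_of_lt_pi hx0 (by linarith [hx.2, pi_pos])
      have h4 : sinPowInt s x ≤ x * sin x ^ s := by
        have := intervalIntegral.integral_mono_on hx.1
          ((continuous_sin_rpow hs.le).intervalIntegrable (μ := volume) 0 x)
          (intervalIntegrable_const (c := sin x ^ s)) (fun y hy =>
            rpow_le_rpow (sin_nonneg_of_nonneg_of_le_pi hy.1 (by linarith [hy.2, hx.2, pi_pos]))
              (sin_le_sin_of_le_of_le_pi_div_two (by linarith [hy.1, pi_pos]) hx.2 hy.2) hs.le)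
        simpa [sinPowInt] using this
      have p := rpow_pos_of_pos hxs s
      rw [rpow_neg hxs.le, inv_mul_le_iff₀ p, mul_comm]
      exact h4
  · exact (hasDerivAt_sin_rpow_mul_sinPowInt hs
      ⟨h0, ht.2.trans_lt hθ.2⟩).continuousAt.continuousWithinAt

theorem youngM_eq {s θ : ℝ} (hs : 0 < s) (hθ : θ ∈ Ioo 0 π) :
    youngM θ s = 2 * (1 / s * (sin θ ^ (-s) * sinPowInt s θ)) := by
  have hc := continuousOn_sin_rpow_mul_sinPowInt hs hθ
  have hd := fun t (ht : t ∈ Ioo 0 θ) =>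
    hasDerivAt_sin_rpow_mul_sinPowInt hs (⟨ht.1, ht.2.trans hθ.2⟩ : t ∈ Ioo 0 π)
  -- Integrability in t comes for free, the integrand being a nonnegative derivative.
  have hi := intervalIntegral.integrableOn_deriv_of_nonneg hc hd (fun t ht =>
    setIntegral_nonneg measurableSet_Ioi fun r hr => div_nonneg (le_of_lt hr)
      (rpow_nonneg (quadratic_pos ⟨ht.1, ht.2.trans hθ.2⟩ r).le _))
  rw [youngM, intervalIntegral.integral_eq_sub_of_hasDerivAt_of_le hθ.1.le hc hd
    ((intervalIntegrable_iff_integrableOn_Ioc_of_le hθ.1.le).2 hi)]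
  simp [sinPowInt_zero]

/-! ### Reduced equation: existence, uniqueness, monotonicity in σ -/

theorem isContactAngle_iff {s σ α : ℝ} (hs : 0 < s) :
    IsContactAngle s σ α ↔
      α ∈ Ioo 0 π ∧ (1 + σ) * sinPowInt s (π / 2) = sinPowInt s α := by
  refine and_congr_right fun hα => ?_
  have hsin := sin_pos_of_mem_Ioo hα
  have p := rpow_pos_of_pos hsin s
  have hP := sinPowInt_pi_div_two_pos hs.le
  rw [youngM_eq hs hα, youngM_eq hs ⟨by positivity, by linarith [pi_pos]⟩, sin_pi_div_two,
    one_rpow, rpow_neg hsin.le]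
  have : sin α ^ s * (2 * (1 / s * ((sin α ^ s)⁻¹ * sinPowInt s α)) /
      (2 * (1 / s * (1 * sinPowInt s (π / 2))))) = sinPowInt s α / sinPowInt s (π / 2) := by
    field_simp
  rw [this, eq_div_iff hP.ne']

theorem exists_isContactAngle {s σ : ℝ} (hs : 0 < s) (hσ : σ ∈ Ioo (-1 : ℝ) 1) :
    ∃ α, IsContactAngle s σ α := by
  have hP := sinPowInt_pi_div_two_pos hs.le
  have h := intermediate_value_Ioo pi_pos.le (continuous_sinPowInt hs.le).continuousOn
  rw [sinPowInt_zero, sinPowInt_pi hs.le] at h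
  have hmem : (1 + σ) * sinPowInt s (π / 2) ∈ Ioo 0 (2 * sinPowInt s (π / 2)) :=
    ⟨mul_pos (by linarith [hσ.1]) hP, mul_lt_mul_of_pos_right (by linarith [hσ.2]) hP⟩
  obtain ⟨α, hα, he⟩ := h hmem
  exact ⟨α, (isContactAngle_iff hs).2 ⟨hα, he.symm⟩⟩

theorem isContactAngle_contactAngle {s σ : ℝ} (hs : 0 < s) (hσ : σ ∈ Ioo (-1 : ℝ) 1) :
    IsContactAngle s σ (contactAngle s σ) :=
  Classical.epsilon_spec (exists_isContactAngle hs hσ)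

theorem isContactAngle_iff_eq_contactAngle {s σ α : ℝ} (hs : 0 < s) (hσ : σ ∈ Ioo (-1 : ℝ) 1) :
    IsContactAngle s σ α ↔ α = contactAngle s σ := by
  have hc := isContactAngle_contactAngle hs hσ
  refine ⟨fun h => ?_, fun h => h ▸ hc⟩
  rw [isContactAngle_iff hs] at h hc
  exact (strictMonoOn_sinPowInt hs.le).injOn (Ioo_subset_Icc_self h.1)
    (Ioo_subset_Icc_self hc.1) (h.2.symm.trans hc.2)

theorem strictMonoOn_contactAngle {s : ℝ} (hs : 0 < s) :
    StrictMonoOn (contactAngle s) (Ioo (-1 : ℝ) 1) := by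
  intro a ha b hb hab
  have h1 := (isContactAngle_iff hs).1 (isContactAngle_contactAngle hs ha)
  have h2 := (isContactAngle_iff hs).1 (isContactAngle_contactAngle hs hb)
  rw [← (strictMonoOn_sinPowInt hs.le).lt_iff_lt (Ioo_subset_Icc_self h1.1)
    (Ioo_subset_Icc_self h2.1), ← h1.2, ← h2.2]
  exact mul_lt_mul_of_pos_right (by linarith) (sinPowInt_pi_div_two_pos hs.le)

/-! ### First-order expansion at the end points -/

/-- Mean value inequality in the exponent; it supplies the integrable majorant |log sin| for the
difference quotients in s. -/
theorem abs_rpow_sub_rpow_le {x a b : ℝ} (hx : 0 < x) (hx1 : x ≤ 1) (ha : 0 ≤ a) (hb : 0 ≤ b) :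
    |x ^ b - x ^ a| ≤ |log x| * |b - a| := by
  refine Convex.norm_image_sub_le_of_norm_hasDerivWithin_le (s := Ici (0 : ℝ))
    (f := fun y => x ^ y) (f' := fun y => x ^ y * log x)
    (fun y _ => (hasStrictDerivAt_const_rpow hx y).hasDerivAt.hasDerivWithinAt)
    (fun y hy => ?_) (convex_Ici 0) ha hb
  rw [norm_mul, norm_eq_abs, norm_eq_abs, abs_of_pos (rpow_pos_of_pos hx y)]
  exact mul_le_of_le_one_left (abs_nonneg _) (rpow_le_one hx.le hx1 hy)

/-- Differentiation of `∫₀^θ (sin φ)^s dφ` with respect to the exponent. -/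
theorem tendsto_slope_sinPowInt {s₀ θ : ℝ} (hs₀ : s₀ ∈ Icc (0 : ℝ) 1) (hs₀' : s₀ ∉ Ioo (0 : ℝ) 1)
    (hθ : θ ∈ Ioo 0 π) :
    Tendsto (fun s => (sinPowInt s θ - sinPowInt s₀ θ) / (s - s₀)) (𝓝[Ioo 0 1] s₀)
      (𝓝 (∫ φ in (0 : ℝ)..θ, sin φ ^ s₀ * log (sin φ))) := by
  have hsub : ∀ φ ∈ uIoc 0 θ, 0 < sin φ := fun φ hφ => by
    rw [uIoc_of_le hθ.1.le] at hφ
    exact sin_pos_of_pos_of_lt_pi hφ.1 (hφ.2.trans_lt hθ.2)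
  have key := intervalIntegral.tendsto_integral_filter_of_dominated_convergence
    (μ := volume) (a := 0) (b := θ) (l := 𝓝[Ioo (0 : ℝ) 1] s₀)
    (F := fun s φ => (sin φ ^ s - sin φ ^ s₀) / (s - s₀))
    (f := fun φ => sin φ ^ s₀ * log (sin φ)) (fun φ => |log (sin φ)|) ?_ ?_ ?_ ?_
  · refine key.congr' ?_
    filter_upwards [self_mem_nhdsWithin] with s hs
    rw [intervalIntegral.integral_div, intervalIntegral.integral_sub
      ((continuous_sin_rpow hs.1.le).intervalIntegrable _ _)
      ((continuous_sin_rpow hs₀.1).intervalIntegrable _ _)]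
    rfl
  · filter_upwards [self_mem_nhdsWithin] with s hs
    exact (((continuous_sin_rpow hs.1.le).sub
      (continuous_sin_rpow hs₀.1)).div_const _).aestronglyMeasurable
  · filter_upwards [self_mem_nhdsWithin] with s hs
    refine Eventually.of_forall fun φ hφ => ?_
    have hne : s - s₀ ≠ 0 := fun h => hs₀' (by rwa [← sub_eq_zero.1 h])
    rw [norm_div, norm_eq_abs, norm_eq_abs, div_le_iff₀ (abs_pos.2 hne)]
    exact abs_rpow_sub_rpow_le (hsub φ hφ) (sin_le_one φ) hs₀.1 hs.1.le
  · exact intervalIntegrable_log_sin.abs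
  · refine Eventually.of_forall fun φ hφ => ?_
    have h := (hasStrictDerivAt_const_rpow (hsub φ hφ) s₀).hasDerivAt
    rw [hasDerivAt_iff_tendsto_slope] at h
    refine (h.mono_left (nhdsWithin_mono _ ?_)).congr fun s => ?_
    · rintro s hs rfl
      exact hs₀' hs
    · rw [slope_def_field]

theorem exists_sinPowInt_sub_eq {s : ℝ} (hs : 0 ≤ s) (a b : ℝ) :
    ∃ ξ ∈ uIcc a b, sinPowInt s b - sinPowInt s a = sin ξ ^ s * (b - a) := by
  have h : ∀ a b : ℝ, a < b → ∃ ξ ∈ Icc a b,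
      sinPowInt s b - sinPowInt s a = sin ξ ^ s * (b - a) := fun a b hab => by
    obtain ⟨ξ, hξ, he⟩ := exists_hasDerivAt_eq_slope (sinPowInt s) (fun x => sin x ^ s) hab
      (continuous_sinPowInt hs).continuousOn (fun x _ => hasDerivAt_sinPowInt hs x)
    exact ⟨ξ, Ioo_subset_Icc_self hξ, by rw [he, div_mul_cancel₀ _ (sub_pos.2 hab).ne']⟩
  rcases lt_trichotomy a b with hab | rfl | hab
  · rw [uIcc_of_le hab.le]; exact h a b hab
  · exact ⟨a, left_mem_uIcc, by simp⟩
  · rw [uIcc_of_ge hab.le]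
    obtain ⟨ξ, hξ, he⟩ := h b a hab
    exact ⟨ξ, hξ, by linarith⟩

/-- As 0 ≤ sin ≤ 1 and s ≤ 1, sin ≤ sin^s. This bound, uniform in s, makes the branch of solutions
converge. -/
theorem cos_sub_cos_le_sinPowInt_sub {s a b : ℝ} (hs : s ∈ Icc (0 : ℝ) 1) (ha : 0 ≤ a)
    (hab : a ≤ b) (hb : b ≤ π) : cos a - cos b ≤ sinPowInt s b - sinPowInt s a := by
  have hi := fun a b => (continuous_sin_rpow hs.1).intervalIntegrable (μ := volume) a b
  rw [sinPowInt, sinPowInt, intervalIntegral.integral_interval_sub_left (hi _ _) (hi _ _),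
    ← integral_sin]
  refine intervalIntegral.integral_mono_on hab (continuous_sin.intervalIntegrable _ _) (hi _ _)
    fun x hx => ?_
  exact self_le_rpow_of_le_one (sin_nonneg_of_nonneg_of_le_pi (ha.trans hx.1) (hx.2.trans hb))
    (sin_le_one x) hs.2

theorem abs_cos_sub_cos_le {s a b : ℝ} (hs : s ∈ Icc (0 : ℝ) 1) (ha : a ∈ Icc 0 π)
    (hb : b ∈ Icc 0 π) : |cos b - cos a| ≤ |sinPowInt s b - sinPowInt s a| := by
  rcases le_total a b with hab | hab
  · have h1 := cos_sub_cos_le_sinPowInt_sub hs ha.1 hab hb.2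
    have h2 := cos_le_cos_of_nonneg_of_le_pi ha.1 hb.2 hab
    rw [abs_sub_comm, abs_of_nonneg (sub_nonneg.2 h2)]
    exact h1.trans (le_abs_self _)
  · have h1 := cos_sub_cos_le_sinPowInt_sub hs hb.1 hab ha.2
    have h2 := cos_le_cos_of_nonneg_of_le_pi hb.1 ha.2 hab
    rw [abs_of_nonneg (sub_nonneg.2 h2), abs_sub_comm]
    exact h1.trans (le_abs_self _)

/-- First-order expansion, at an end point `s₀` of `(0, 1)`, of a branch of solutions `θ s` of
`(1 + σ) ∫₀^{π/2} sin^s = ∫₀^{θ s} sin^s`. -/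
theorem isLittleO_branch {s₀ σ θ₀ : ℝ} {θ : ℝ → ℝ} (hs₀ : s₀ ∈ Icc (0 : ℝ) 1)
    (hs₀' : s₀ ∉ Ioo (0 : ℝ) 1) (hθ₀ : θ₀ ∈ Ioo 0 π)
    (h₀ : (1 + σ) * sinPowInt s₀ (π / 2) = sinPowInt s₀ θ₀)
    (hθ : ∀ s ∈ Ioo (0 : ℝ) 1, θ s ∈ Ioo 0 π ∧
      (1 + σ) * sinPowInt s (π / 2) = sinPowInt s (θ s)) :
    (fun s => θ s - (θ₀ + ((1 + σ) * (∫ φ in (0 : ℝ)..(π / 2), sin φ ^ s₀ * log (sin φ)) -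
        ∫ φ in (0 : ℝ)..θ₀, sin φ ^ s₀ * log (sin φ)) / sin θ₀ ^ s₀ * (s - s₀)))
      =o[𝓝[Ioo 0 1] s₀] fun s => s - s₀ := by
  -- R is the residual left by the limit angle θ₀ in the equation for s; it vanishes at s₀ and has
  -- slope K there.
  set R : ℝ → ℝ := fun s => (1 + σ) * sinPowInt s (π / 2) - sinPowInt s θ₀ with hR
  set K := (1 + σ) * (∫ φ in (0 : ℝ)..(π / 2), sin φ ^ s₀ * log (sin φ)) -
        ∫ φ in (0 : ℝ)..θ₀, sin φ ^ s₀ * log (sin φ) with hK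
  have hpos : 0 < sin θ₀ ^ s₀ := rpow_pos_of_pos (sin_pos_of_mem_Ioo hθ₀) _
  have hne : ∀ s ∈ Ioo (0 : ℝ) 1, s - s₀ ≠ 0 := fun s hs h => hs₀' (by rwa [← sub_eq_zero.1 h])
  have hslope : Tendsto (fun s => R s / (s - s₀)) (𝓝[Ioo 0 1] s₀) (𝓝 K) := by
    refine (((tendsto_slope_sinPowInt hs₀ hs₀' ⟨half_pos pi_pos, half_lt_self pi_pos⟩).const_mul
      (1 + σ)).sub (tendsto_slope_sinPowInt hs₀ hs₀' hθ₀)).congr fun s => ?_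
    simp only [hR]
    rw [← mul_div_assoc, ← sub_div]
    congr 1
    linear_combination -h₀
  have hid : Tendsto (fun s : ℝ => s) (𝓝[Ioo 0 1] s₀) (𝓝 s₀) := nhdsWithin_le_nhds
  have hRlim : Tendsto R (𝓝[Ioo 0 1] s₀) (𝓝 0) := by
    have h := hslope.mul (hid.sub_const s₀)
    rw [sub_self, mul_zero] at h
    refine h.congr' ?_
    filter_upwards [self_mem_nhdsWithin] with s hs
    exact div_mul_cancel₀ _ (hne s hs)
  have hRθ : ∀ s ∈ Ioo (0 : ℝ) 1, R s = sinPowInt s (θ s) - sinPowInt s θ₀ := fun s hs => by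
    simp only [hR]; rw [(hθ s hs).2]
  have hcos : Tendsto (fun s => cos (θ s)) (𝓝[Ioo 0 1] s₀) (𝓝 (cos θ₀)) := by
    rw [tendsto_iff_norm_sub_tendsto_zero]
    refine squeeze_zero' (Eventually.of_forall fun _ => norm_nonneg _) ?_ (by simpa using hRlim.abs)
    filter_upwards [self_mem_nhdsWithin] with s hs
    rw [hRθ s hs]
    exact abs_cos_sub_cos_le (Ioo_subset_Icc_self hs) (Ioo_subset_Icc_self hθ₀)
      (Ioo_subset_Icc_self (hθ s hs).1)
  have hθlim : Tendsto θ (𝓝[Ioo 0 1] s₀) (𝓝 θ₀) := by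
    have h := (continuous_arccos.tendsto _).comp hcos
    rw [arccos_cos hθ₀.1.le hθ₀.2.le] at h
    refine h.congr' ?_
    filter_upwards [self_mem_nhdsWithin] with s hs
    exact arccos_cos (hθ s hs).1.1.le (hθ s hs).1.2.le
  -- The mean value theorem gives R s = sin^s ξ · (θ s - θ₀) with ξ → θ₀; dividing by s - s₀ yields
  -- the derivative of the branch.
  have hmv : ∀ s, ∃ ξ, s ∈ Ioo (0 : ℝ) 1 → ξ ∈ uIcc θ₀ (θ s) ∧
      sinPowInt s (θ s) - sinPowInt s θ₀ = sin ξ ^ s * (θ s - θ₀) := fun s => by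
    by_cases hs : s ∈ Ioo (0 : ℝ) 1
    · obtain ⟨ξ, h1, h2⟩ := exists_sinPowInt_sub_eq hs.1.le θ₀ (θ s)
      exact ⟨ξ, fun _ => ⟨h1, h2⟩⟩
    · exact ⟨0, fun h => absurd h hs⟩
  choose ξ hξ using hmv
  have hξlim : Tendsto ξ (𝓝[Ioo 0 1] s₀) (𝓝 θ₀) := by
    rw [tendsto_iff_norm_sub_tendsto_zero]
    refine squeeze_zero' (Eventually.of_forall fun _ => norm_nonneg _) ?_
      (tendsto_iff_norm_sub_tendsto_zero.1 hθlim)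
    filter_upwards [self_mem_nhdsWithin] with s hs
    exact abs_sub_left_of_mem_uIcc (hξ s hs).1
  have hsinξ : Tendsto (fun s => sin (ξ s) ^ s) (𝓝[Ioo 0 1] s₀) (𝓝 (sin θ₀ ^ s₀)) :=
    ((continuous_sin.tendsto θ₀).comp hξlim).rpow hid (Or.inl (sin_pos_of_mem_Ioo hθ₀).ne')
  have hquot : Tendsto (fun s => (θ s - θ₀) / (s - s₀)) (𝓝[Ioo 0 1] s₀)
      (𝓝 (K / sin θ₀ ^ s₀)) := by
    refine (hslope.div hsinξ hpos.ne').congr' ?_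
    filter_upwards [self_mem_nhdsWithin, hsinξ.eventually (lt_mem_nhds hpos)] with s hs hs'
    simp only [Pi.div_apply]
    rw [hRθ s hs, (hξ s hs).2]
    have := hne s hs
    field_simp
  rw [Asymptotics.isLittleO_iff_tendsto' (by
    filter_upwards [self_mem_nhdsWithin] with s hs h using absurd h (hne s hs))]
  have h := hquot.sub_const (K / sin θ₀ ^ s₀)
  rw [sub_self] at h
  refine h.congr' ?_
  filter_upwards [self_mem_nhdsWithin] with s hs
  have := hne s hs
  field_simp
  ring

/-! ### The log-sine integrals -/

/-- Integrate by means of 2 log sin = log(1 - cos) + log(1 + cos); the constant log 2 makes the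
primitive vanish at 0. -/
theorem integral_sin_mul_log_sin {θ : ℝ} (hθ : θ ∈ Ioo 0 π) :
    ∫ φ in (0 : ℝ)..θ, sin φ * log (sin φ) =
      1 / 2 * ((1 - cos θ) * log (1 - cos θ)) - 1 / 2 * ((1 + cos θ) * log (1 + cos θ)) -
        (1 - cos θ) + log 2 := by
  have hc : Continuous fun x : ℝ => 1 / 2 * ((1 - cos x) * log (1 - cos x)) -
      1 / 2 * ((1 + cos x) * log (1 + cos x)) - (1 - cos x) + log 2 := by
    have h1 : Continuous fun x : ℝ => (1 - cos x) * log (1 - cos x) :=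
      continuous_mul_log.comp (continuous_const.sub continuous_cos)
    have h2 : Continuous fun x : ℝ => (1 + cos x) * log (1 + cos x) :=
      continuous_mul_log.comp (continuous_const.add continuous_cos)
    fun_prop
  have hi : Continuous fun x : ℝ => sin x * log (sin x) := continuous_mul_log.comp continuous_sin
  rw [intervalIntegral.integral_eq_sub_of_hasDerivAt_of_le hθ.1.le hc.continuousOn ?_
    (hi.intervalIntegrable _ _)]
  · norm_num
    ring
  · intro x hx
    have hsin := sin_pos_of_pos_of_lt_pi hx.1 (hx.2.trans hθ.2)
    have hsq := sin_sq_add_cos_sq x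
    have p1 : 0 < 1 - cos x := by nlinarith [cos_le_one x]
    have p2 : 0 < 1 + cos x := by nlinarith [neg_one_le_cos x]
    have d1 := (hasDerivAt_mul_log p1.ne').comp x ((hasDerivAt_cos x).const_sub 1)
    have d2 := (hasDerivAt_mul_log p2.ne').comp x ((hasDerivAt_cos x).const_add 1)
    have d := (((d1.const_mul (1 / 2)).sub (d2.const_mul (1 / 2))).sub
      ((hasDerivAt_cos x).const_sub 1)).add_const (log 2)
    refine d.congr_deriv ?_
    have hl : log (1 - cos x) + log (1 + cos x) = 2 * log (sin x) := by
      rw [← log_mul p1.ne' p2.ne', show (1 - cos x) * (1 + cos x) = sin x ^ 2 by linarith, log_pow]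
      norm_num
    linear_combination (1 / 2 * sin x) * hl

theorem sinc_pos {t : ℝ} (h0 : 0 ≤ t) (hπ : t < π) : 0 < sinc t := by
  rcases eq_or_lt_of_le h0 with rfl | h
  · simp
  · rw [sinc_of_ne_zero h.ne']
    exact div_pos (sin_pos_of_pos_of_lt_pi h hπ) h

/-- t / tan t agrees on (0, θ] with the continuous cos t / sinc t, even at π/2, where both are 0. -/
theorem intervalIntegrable_div_tan {θ : ℝ} (hθ : θ ∈ Ioo 0 π) :
    IntervalIntegrable (fun t => t / tan t) volume 0 θ := by
  have hc : ContinuousOn (fun t => cos t / sinc t) (uIcc 0 θ) := by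
    rw [uIcc_of_le hθ.1.le]
    exact continuous_cos.continuousOn.div continuous_sinc.continuousOn fun t ht =>
      (sinc_pos ht.1 (ht.2.trans_lt hθ.2)).ne'
  refine hc.intervalIntegrable.congr fun t ht => ?_
  rw [uIoc_of_le hθ.1.le] at ht
  rw [sinc_of_ne_zero ht.1.ne', tan_eq_sin_div_cos, div_div_eq_mul_div, div_div_eq_mul_div,
    mul_comm]

/-- Integration by parts; the boundary term at 0 is harmless because t log sin t = t log t + t log
sinc t is continuous there. -/
theorem integral_log_sin_eq_sub_youngXi {θ : ℝ} (hθ : θ ∈ Ioo 0 π) :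
    ∫ φ in (0 : ℝ)..θ, log (sin φ) = θ * log (sin θ) - youngXi θ := by
  have hl : IntervalIntegrable (fun φ => log (sin φ)) volume 0 θ := intervalIntegrable_log_sin
  have ht := intervalIntegrable_div_tan hθ
  have hc : ContinuousOn (fun t => t * log (sin t)) (Icc 0 θ) := by
    have h : ContinuousOn (fun t => t * log t + t * log (sinc t)) (Icc 0 θ) :=
      continuous_mul_log.continuousOn.add (continuousOn_id.mul
        (continuous_sinc.continuousOn.log fun t ht => (sinc_pos ht.1 (ht.2.trans_lt hθ.2)).ne'))
    refine h.congr fun t ht => ?_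
    rcases eq_or_lt_of_le ht.1 with rfl | h0
    · simp
    · have := sin_pos_of_pos_of_lt_pi h0 (ht.2.trans_lt hθ.2)
      simp only
      rw [sinc_of_ne_zero h0.ne', log_div this.ne' h0.ne']
      ring
  have key := intervalIntegral.integral_eq_sub_of_hasDerivAt_of_le
    (f' := fun t => log (sin t) + t / tan t) hθ.1.le hc (fun t ht => ?_) (hl.add ht)
  · rw [intervalIntegral.integral_add hl ht, zero_mul, sub_zero] at key
    rw [youngXi]
    linarith
  · have := sin_pos_of_pos_of_lt_pi ht.1 (ht.2.trans hθ.2)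
    refine ((hasDerivAt_id t).mul ((hasDerivAt_sin t).log this.ne')).congr_deriv ?_
    rw [tan_eq_sin_div_cos, div_div_eq_mul_div]
    simp only [id]
    ring

theorem sinPowInt_zero_left (θ : ℝ) : sinPowInt 0 θ = θ := by simp [sinPowInt]

theorem sinPowInt_one_left (θ : ℝ) : sinPowInt 1 θ = 1 - cos θ := by simp [sinPowInt]

theorem contactAngle_expansion_one {σ : ℝ} (hσ : σ ∈ Ioo (-1 : ℝ) 1) :
    (fun s : ℝ => contactAngle s σ - (arccos (-σ) -
        (2 * σ * log 2 + (1 - σ) * log (1 - σ) - (1 + σ) * log (1 + σ)) /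
          (2 * √(1 - σ ^ 2)) * (1 - s))) =o[𝓝[<] 1] fun s : ℝ => 1 - s := by
  have hcos : cos (arccos (-σ)) = -σ := cos_arccos (by linarith [hσ.2]) (by linarith [hσ.1])
  have hsin : sin (arccos (-σ)) = √(1 - σ ^ 2) := by rw [sin_arccos, neg_sq]
  have hpos : 0 < √(1 - σ ^ 2) := sqrt_pos.2 (by nlinarith [hσ.1, hσ.2])
  have hmem : arccos (-σ) ∈ Ioo 0 π :=
    ⟨arccos_pos.2 (by linarith [hσ.1]), (arccos_le_pi _).lt_of_ne fun h => by
      rw [h, sin_pi] at hsin; exact hpos.ne hsin⟩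
  have h := isLittleO_branch (s₀ := 1) (σ := σ) (θ := fun s => contactAngle s σ)
    (by simp) (by simp) hmem
    (by rw [sinPowInt_one_left, sinPowInt_one_left, hcos, cos_pi_div_two]; ring)
    (fun s hs => (isContactAngle_iff hs.1).1 (isContactAngle_contactAngle hs.1 hσ))
  simp only [rpow_one] at h
  rw [nhdsWithin_Ioo_eq_nhdsLT one_pos, integral_sin_mul_log_sin hmem,
    integral_sin_mul_log_sin ⟨half_pos pi_pos, half_lt_self pi_pos⟩, hcos, hsin,
    cos_pi_div_two] at h
  refine (h.neg_right.congr (fun s => ?_) (fun s => by ring))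
  simp only [sub_zero, add_zero, log_one, sub_neg_eq_add, ← sub_eq_add_neg]
  field_simp
  ring

theorem contactAngle_expansion_zero {σ : ℝ} (hσ : σ ∈ Ioo (-1 : ℝ) 1) :
    (fun s : ℝ => contactAngle s σ - (π / 2 * (1 + σ) -
        (π / 2 * (1 + σ) * log (cos (π * σ / 2)) - youngXi (π / 2 * (1 + σ)) +
          (1 + σ) * youngXi (π / 2)) * s)) =o[𝓝[>] 0] fun s : ℝ => s := by
  have hmem : π / 2 * (1 + σ) ∈ Ioo 0 π :=
    ⟨mul_pos (half_pos pi_pos) (by linarith [hσ.1]), by nlinarith [hσ.2, pi_pos]⟩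
  have hsin : sin (π / 2 * (1 + σ)) = cos (π * σ / 2) := by
    rw [← sin_add_pi_div_two]; congr 1; ring
  have h := isLittleO_branch (s₀ := 0) (σ := σ) (θ := fun s => contactAngle s σ)
    (by simp) (by simp) hmem
    (by rw [sinPowInt_zero_left, sinPowInt_zero_left]; ring)
    (fun s hs => (isContactAngle_iff hs.1).1 (isContactAngle_contactAngle hs.1 hσ))
  simp only [rpow_zero, one_mul, sub_zero] at h
  rw [nhdsWithin_Ioo_eq_nhdsGT one_pos, integral_log_sin_eq_sub_youngXi hmem,
    integral_log_sin_eq_sub_youngXi ⟨half_pos pi_pos, half_lt_self pi_pos⟩, hsin,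
    sin_pi_div_two, log_one] at h
  refine h.congr_left fun s => ?_
  ring

end FractionalYoung

theorem theorem1p1 :
    (∀ s ∈ Set.Ioo (0 : ℝ) 1, ∀ σ ∈ Set.Ioo (-1 : ℝ) 1, ∀ α : ℝ,
      IsContactAngle s σ α ↔ α = contactAngle s σ) ∧
    (∀ s ∈ Set.Ioo (0 : ℝ) 1, StrictMonoOn (contactAngle s) (Set.Ioo (-1 : ℝ) 1)) ∧
    (∀ σ ∈ Set.Ioo (-1 : ℝ) 1,
      Asymptotics.IsLittleO (nhdsWithin (1 : ℝ) (Set.Iio 1))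
        (fun s : ℝ => contactAngle s σ -
          (Real.arccos (-σ) -
            (2 * σ * Real.log 2 + (1 - σ) * Real.log (1 - σ) - (1 + σ) * Real.log (1 + σ)) /
              (2 * Real.sqrt (1 - σ ^ 2)) * (1 - s)))
        (fun s : ℝ => 1 - s)) ∧
    (∀ σ ∈ Set.Ioo (-1 : ℝ) 1,
      Asymptotics.IsLittleO (nhdsWithin (0 : ℝ) (Set.Ioi 0))
        (fun s : ℝ => contactAngle s σ -
          (Real.pi / 2 * (1 + σ) -
            (Real.pi / 2 * (1 + σ) * Real.log (Real.cos (Real.pi * σ / 2)) -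
              youngXi (Real.pi / 2 * (1 + σ)) + (1 + σ) * youngXi (Real.pi / 2)) * s))
        (fun s : ℝ => s)) :=
  ⟨fun _ hs _ hσ _ => isContactAngle_iff_eq_contactAngle hs.1 hσ,
    fun _ hs => strictMonoOn_contactAngle hs.1,
    fun _ hσ => contactAngle_expansion_one hσ,
    fun _ hσ => contactAngle_expansion_zero hσ⟩
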